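/- Let $G$ and $H$ be (finite-dimensional, real) Lie groups with Lie algebras $\mathfrak g$, $\mathfrak h$, let $\iota\colon G\hookrightarrow H$ be the inclusion of a Lie subgroup (an injective immersive homomorphism), and let $\pi\colon P\to M$ be a smooth principal $G$-bundle with right action $r^g(u)=u\cdot g$ and fundamental vector fields $\zeta_X(u)=T_e(g\mapsto u\cdot g)X$, $X\in\mathfrak g$. Let $q\colon P\times H\to P[H]=P\times_G H$ be the quotient by $(u\cdot g,h)\sim(u,\iota(g)h)$; $P[H]$ is regarded as a principal $H$-bundle over $M$ with the action $q(u,h)\cdot k=q(u,hk)$ and with the smooth structure for which every local trivialization $u\mapsto(\pi(u),\gamma(u))$ of $P$ induces the local trivialization $q(u,h)\mapsto(\pi(u),\iota(\gamma(u))h)$. Write $\lambda_h$ for left translation by $h$ on $H$. A generalized Cartan connection is a smooth one-form $\kappa\in\Omega^1(P;\mathfrak h)$ with $\kappa\circ T(r^g)=\mathrm{Ad}(\iota(g)^{-1})\circ\kappa$ for all $g\in G$ and $\kappa(\zeta_X(u))=T_e\iota\,X$ for all $X\in\mathfrak g$, $u\in P$. A principal connection form on a principal $H$-bundle $Q$ is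 a smooth one-form $\omega\in\Omega^1(Q;\mathfrak h)$ with $\omega\circ T(r^k)=\mathrm{Ad}(k^{-1})\circ\omega$ for all $k\in H$ and $\omega(\zeta_Y)=Y$ for all $Y\in\mathfrak h$. Then there is a bijection $\kappa\mapsto q^\flat\kappa$ from the generalized Cartan connections on $P$ with values in $\mathfrak h$ onto the principal connection forms on $P[H]$ such that $$(q^\flat\kappa)\bigl(T_{(u,h)}q(X_u,T_e\lambda_h Y)\bigr)=Y+\mathrm{Ad}(h^{-1})\kappa_u(X_u)\qquad(u\in P,\ h\in H,\ X_u\in T_uP,\ Y\in\mathfrak h).$$ This formula determines the form $q^\flat\kappa$ uniquely among all families of linear maps $T_yP[H]\to\mathfrak h$ ($y\in P[H]$), and the inverse bijection is given by $$\bigl((q^\flat)^{-1}\omega\bigr)(X_u)=\omega\bigl(T_{(u,e)}q(X_u,0_e)\bigr).$$ -/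

import Mathlib

open scoped Manifold ContDiff Topology

noncomputable section

section PrincipalBundles

variable {EP KP EM KM EG KG EH KH : Type*}
  [NormedAddCommGroup EP] [NormedSpace ℝ EP] [TopologicalSpace KP]
  [NormedAddCommGroup EM] [NormedSpace ℝ EM] [TopologicalSpace KM]
  [NormedAddCommGroup EG] [NormedSpace ℝ EG] [TopologicalSpace KG]
  [NormedAddCommGroup EH] [NormedSpace ℝ EH] [TopologicalSpace KH]

/-- Smoothness on a model space, read in the model vector space. -/
theorem contDiffOn_of_contMDiffOn_model {I : ModelWithCorners ℝ EM KM} {f : KM → KM} {s : Set KM}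
    (h : ContMDiffOn I I ∞ f s) : ContDiffOn ℝ ∞ (I ∘ f ∘ I.symm) (I.symm ⁻¹' s ∩ Set.range I) := by
  intro z hz
  have := (contMDiffOn_iff.1 h).2 (I.symm z) (I.symm z)
  simp only [extChartAt, chartAt_self_eq, mfld_simps] at this
  rw [Set.inter_comm] at hz ⊢
  exact this z hz

/-- A local trivialization `π⁻¹(U) ≅ U × G` that is a diffeomorphism and intertwines the right
action `act` with right multiplication on the second factor. -/
structure IsPrincipalTrivialization
    (IP : ModelWithCorners ℝ EP KP) (IM : ModelWithCorners ℝ EM KM) (IG : ModelWithCorners ℝ EG KG)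
    {P M G : Type*}
    [TopologicalSpace P] [ChartedSpace KP P] [TopologicalSpace M] [ChartedSpace KM M]
    [TopologicalSpace G] [ChartedSpace KG G] [Group G]
    {proj : P → M} (act : P → G → P) (e : Bundle.Trivialization G proj) : Prop where
  contMDiffOn : ContMDiffOn IP (IM.prod IG) ∞ e e.source
  contMDiffOn_symm : ContMDiffOn (IM.prod IG) IP ∞ e.toOpenPartialHomeomorph.symm e.target
  equivariant : ∀ u ∈ e.source, ∀ g : G, (e (act u g)).2 = (e u).2 * g

/-- A smooth principal `G`-bundle with total space `P` and base `M`: a smooth right action of `G`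
on `P` preserving the fibres of `proj : P → M`, with smooth equivariant local trivializations
around every point of `M`. -/
structure PrincipalBundle
    (IP : ModelWithCorners ℝ EP KP) (IM : ModelWithCorners ℝ EM KM) (IG : ModelWithCorners ℝ EG KG)
    (P M G : Type*)
    [TopologicalSpace P] [ChartedSpace KP P] [TopologicalSpace M] [ChartedSpace KM M]
    [TopologicalSpace G] [ChartedSpace KG G] [Group G] where
  proj : P → M
  act : P → G → P
  contMDiff_proj : ContMDiff IP IM ∞ proj
  contMDiff_act : ContMDiff (IP.prod IG) IP ∞ fun p : P × G => act p.1 p.2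
  act_one : ∀ u, act u 1 = u
  act_mul : ∀ u g g', act u (g * g') = act (act u g) g'
  proj_act : ∀ u g, proj (act u g) = proj u
  exists_trivialization : ∀ x : M, ∃ e : Bundle.Trivialization G proj,
    x ∈ e.baseSet ∧ IsPrincipalTrivialization IP IM IG act e

/-- The homomorphism `ι : G → H` of Lie groups is the inclusion of a Lie subgroup: an injective
immersion. -/
structure IsLieSubgroup {IG : ModelWithCorners ℝ EG KG} {IH : ModelWithCorners ℝ EH KH}
    {G H : Type*} [TopologicalSpace G] [ChartedSpace KG G] [Group G]
    [TopologicalSpace H] [ChartedSpace KH H] [Group H]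
    (ι : ContMDiffMonoidMorphism IG IH ∞ G H) : Prop where
  injective : Function.Injective ι
  immersion : ∀ g : G, Function.Injective (mfderiv IG IH ι g)

/-- The adjoint representation: `Ad(h)` is the derivative at `1` of `k ↦ h k h⁻¹`. -/
def lieAd {H : Type*} [TopologicalSpace H] [ChartedSpace KH H] [Group H]
    (IH : ModelWithCorners ℝ EH KH) (h : H) :
    GroupLieAlgebra IH H →L[ℝ] GroupLieAlgebra IH H :=
  mfderiv IH IH (fun k : H => h * k * h⁻¹) 1

namespace PrincipalBundle

variable {IP : ModelWithCorners ℝ EP KP} {IM : ModelWithCorners ℝ EM KM}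
  {IG : ModelWithCorners ℝ EG KG} {IH : ModelWithCorners ℝ EH KH}
  {P M G H : Type*}
  [TopologicalSpace P] [ChartedSpace KP P]
  [TopologicalSpace M] [ChartedSpace KM M]
  [TopologicalSpace G] [ChartedSpace KG G] [Group G]
  [TopologicalSpace H] [ChartedSpace KH H] [Group H]

/-- The fundamental vector field `ζ_X(u) = T_e(r_u) X`. -/
def fundamental (B : PrincipalBundle IP IM IG P M G) (X : GroupLieAlgebra IG G) (u : P) :
    TangentSpace IP u :=
  mfderiv IG IP (fun g : G => B.act u g) 1 X

/-- A generalized principal Cartan connection on `P` with values in the Lie algebra of `H`, where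
`ι : G → H`: a smooth one-form `κ : TP → 𝔥` with `κ ∘ T(r^g) = Ad(g⁻¹) ∘ κ` and `κ(ζ_X) = X`. -/
structure GeneralizedCartanConnection [IsManifold IP ∞ P]
    (B : PrincipalBundle IP IM IG P M G) (ι : ContMDiffMonoidMorphism IG IH ∞ G H) where
  form : ∀ u : P, TangentSpace IP u →L[ℝ] GroupLieAlgebra IH H
  smooth : ContMDiff (M' := EH) IP.tangent 𝓘(ℝ, EH) ∞
    fun v : TangentBundle IP P => form v.1 v.2
  equivariant : ∀ (u : P) (g : G) (X : TangentSpace IP u),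
    form (B.act u g) (mfderiv IP IP (fun v : P => B.act v g) u X)
      = lieAd IH (ι g⁻¹) (form u X)
  reproduces : ∀ (u : P) (X : GroupLieAlgebra IG G),
    form u (B.fundamental X u) = mfderiv IG IH ι 1 X

/-- A principal connection form on a principal `G`-bundle: a smooth one-form `ω : TP → 𝔤` with
`ω ∘ T(r^g) = Ad(g⁻¹) ∘ ω` and `ω(ζ_X) = X`. -/
structure PrincipalConnection [IsManifold IP ∞ P] (B : PrincipalBundle IP IM IG P M G) where
  form : ∀ u : P, TangentSpace IP u →L[ℝ] GroupLieAlgebra IG G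
  smooth : ContMDiff (M' := EG) IP.tangent 𝓘(ℝ, EG) ∞
    fun v : TangentBundle IP P => form v.1 v.2
  equivariant : ∀ (u : P) (g : G) (X : TangentSpace IP u),
    form (B.act u g) (mfderiv IP IP (fun v : P => B.act v g) u X) = lieAd IG g⁻¹ (form u X)
  reproduces : ∀ (u : P) (X : GroupLieAlgebra IG G), form u (B.fundamental X u) = X

section Extension

variable (B : PrincipalBundle IP IM IG P M G) (ι : ContMDiffMonoidMorphism IG IH ∞ G H)

/-- The orbit relation of `G` on `P × H`, generated by `(u g, h) ∼ (u, g h)`. -/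
def extSetoid : Setoid (P × H) where
  r a b := ∃ g : G, b.1 = B.act a.1 g ∧ a.2 = ι g * b.2
  iseqv := by
    refine ⟨fun a => ⟨1, by simp [B.act_one]⟩, ?_, ?_⟩
    · rintro ⟨u, h⟩ ⟨u', h'⟩ ⟨g, h1, h2⟩
      refine ⟨g⁻¹, ?_, ?_⟩
      · simp only at h1
        simp only [h1, ← B.act_mul, mul_inv_cancel, B.act_one]
      · simp only at h2
        simp only [h2, map_inv, inv_mul_cancel_left]
    · rintro ⟨u, h⟩ ⟨u', h'⟩ ⟨u'', h''⟩ ⟨g, h1, h2⟩ ⟨g', h3, h4⟩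
      refine ⟨g * g', ?_, ?_⟩
      · simp only at h1 h3
        simp only [h3, h1, B.act_mul]
      · simp only at h2 h4
        simp only [h2, h4, map_mul, mul_assoc]

/-- The total space `P[H] = P ×_G H` of the extension of the structure group. -/
def Ext : Type _ := Quotient (B.extSetoid ι)

instance : TopologicalSpace (B.Ext ι) := inferInstanceAs (TopologicalSpace (Quotient _))

/-- The projection `q : P × H → P[H]`. -/
def extMk (p : P × H) : B.Ext ι := Quotient.mk (B.extSetoid ι) p

theorem extMk_act (u : P) (g : G) (h : H) :
    B.extMk ι (B.act u g, h) = B.extMk ι (u, ι g * h) :=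
  (Quotient.sound (s := B.extSetoid ι) ⟨g, rfl, rfl⟩).symm

theorem isQuotientMap_extMk : Topology.IsQuotientMap (B.extMk ι) := isQuotientMap_quotient_mk'

theorem extMk_surjective : Function.Surjective (B.extMk ι) := Quotient.mk_surjective

/-- The map on `P[H]` induced by a `G`-invariant map on `P × H`. -/
def extLift {α : Type*} (f : P × H → α)
    (hf : ∀ (u : P) (g : G) (h : H), f (B.act u g, h) = f (u, ι g * h)) : B.Ext ι → α :=
  Quotient.lift f (by
    rintro ⟨u, h⟩ ⟨u', h'⟩ ⟨g, h1, h2⟩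
    have h1' : u' = B.act u g := h1
    have h2' : h = ι g * h' := h2
    rw [h1', h2', hf])

@[simp] theorem extLift_mk {α : Type*} (f : P × H → α)
    (hf : ∀ (u : P) (g : G) (h : H), f (B.act u g, h) = f (u, ι g * h)) (p : P × H) :
    B.extLift ι f hf (B.extMk ι p) = f p := rfl

/-- The bundle projection `P[H] → M`, `q(u, h) ↦ π(u)`. -/
def extProj : B.Ext ι → M :=
  B.extLift ι (fun p => B.proj p.1) fun u g _ => B.proj_act u g

@[simp] theorem extProj_mk (u : P) (h : H) : B.extProj ι (B.extMk ι (u, h)) = B.proj u := rfl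

theorem continuous_extProj : Continuous (B.extProj ι) :=
  (B.isQuotientMap_extMk ι).continuous_iff.2 (B.contMDiff_proj.continuous.comp continuous_fst)

/-- The right action of `H` on `P[H]`: `q(u, h) h' = q(u, h h')`. -/
def extAct (x : B.Ext ι) (k : H) : B.Ext ι :=
  B.extLift ι (fun p => B.extMk ι (p.1, p.2 * k))
    (fun u g h => by simp only [B.extMk_act, mul_assoc]) x

@[simp] theorem extAct_mk (u : P) (h k : H) :
    B.extAct ι (B.extMk ι (u, h)) k = B.extMk ι (u, h * k) := rfl

theorem extProj_act (x : B.Ext ι) (k : H) : B.extProj ι (B.extAct ι x k) = B.extProj ι x := by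
  obtain ⟨⟨u, h⟩, rfl⟩ := B.extMk_surjective ι x
  rfl

variable {B} {e : Bundle.Trivialization G B.proj}

theorem trivialization_inv_act (he : IsPrincipalTrivialization IP IM IG B.act e) {u : P}
    (hu : B.proj u ∈ e.baseSet) :
    B.act (e.toOpenPartialHomeomorph.symm (B.proj u, 1)) (e u).2 = u := by
  have h1 : (B.proj u, (1 : G)) ∈ e.target := by simp [e.target_eq, hu]
  have h2 := e.map_target h1
  have h3 := e.proj_symm_apply h1
  have h4 := e.apply_symm_apply h1
  have h5 : e (B.act (e.toOpenPartialHomeomorph.symm (B.proj u, 1)) (e u).2) = e u := by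
    apply Prod.ext
    · rw [e.coe_fst' (by rw [B.proj_act, h3]; exact hu), e.coe_fst' hu, B.proj_act, h3]
    · rw [he.equivariant _ h2, h4, one_mul]
  refine e.injOn ?_ ?_ h5
  · rw [e.mem_source, B.proj_act]; exact (e.mem_source).1 h2
  · exact (e.mem_source).2 hu

variable [LieGroup IH ∞ H]

open Classical in
/-- The trivialization `q(u, h) ↦ (π(u), γ(u) h)` of `P[H]` over `U` that is induced by a
trivialization `u ↦ (π(u), γ(u))` of `P` over `U` (with a junk value away from `U`). -/
def extTrivialization (ι : ContMDiffMonoidMorphism IG IH ∞ G H)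
    (he : IsPrincipalTrivialization IP IM IG B.act e) :
    Bundle.Trivialization H (B.extProj ι) where
  toFun := B.extLift ι
    (fun p => (B.proj p.1, if B.proj p.1 ∈ e.baseSet then ι (e p.1).2 * p.2 else 1)) (by
      intro u g h
      simp only [B.proj_act]
      split_ifs with hu
      · rw [he.equivariant u (e.mem_source.2 hu), map_mul, mul_assoc]
      · rfl)
  invFun y := B.extMk ι (e.toOpenPartialHomeomorph.symm (y.1, 1), y.2)
  source := B.extProj ι ⁻¹' e.baseSet
  target := e.baseSet ×ˢ Set.univ
  map_source' := by
    intro x hx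
    obtain ⟨⟨u, h⟩, rfl⟩ := B.extMk_surjective ι x
    exact ⟨hx, trivial⟩
  map_target' := by
    rintro ⟨x, h⟩ ⟨hx, -⟩
    have h1 : (x, (1 : G)) ∈ e.target := by rw [e.target_eq]; exact ⟨hx, trivial⟩
    simp only [Set.mem_preimage, extProj_mk]
    rw [e.proj_symm_apply h1]; exact hx
  left_inv' := by
    intro x hx
    obtain ⟨⟨u, h⟩, rfl⟩ := B.extMk_surjective ι x
    have hu : B.proj u ∈ e.baseSet := hx
    change B.extMk ι (e.toOpenPartialHomeomorph.symm (B.proj u, 1),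
      if B.proj u ∈ e.baseSet then ι (e u).2 * h else 1) = _
    rw [if_pos hu, ← B.extMk_act, trivialization_inv_act he hu]
  right_inv' := by
    rintro ⟨x, h⟩ ⟨hx, -⟩
    have h1 : (x, (1 : G)) ∈ e.target := by rw [e.target_eq]; exact ⟨hx, trivial⟩
    have h3 := e.proj_symm_apply h1
    have h4 := e.apply_symm_apply h1
    change (B.proj (e.toOpenPartialHomeomorph.symm (x, 1)),
      if B.proj (e.toOpenPartialHomeomorph.symm (x, 1)) ∈ e.baseSet then
        ι (e (e.toOpenPartialHomeomorph.symm (x, 1))).2 * h else 1) = _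
    rw [h3, if_pos hx, h4, map_one, one_mul]
  open_source := e.open_baseSet.preimage (B.continuous_extProj ι)
  open_target := e.open_baseSet.prod isOpen_univ
  continuousOn_toFun := by
    have := topologicalGroup_of_lieGroup IH ∞ (G := H)
    have hι : Continuous ι := ι.contMDiff_toFun.continuous
    refine ((B.isQuotientMap_extMk ι).continuousOn_isOpen_iff
      (e.open_baseSet.preimage (B.continuous_extProj ι))).2 ?_
    have hmaps : Set.MapsTo (Prod.fst : P × H → P)
        (B.extMk ι ⁻¹' (B.extProj ι ⁻¹' e.baseSet)) e.source := by
      rintro ⟨u, h⟩ hu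
      exact e.mem_source.2 hu
    have h1 : ContinuousOn (fun p : P × H => (B.proj p.1, ι (e p.1).2 * p.2))
        (B.extMk ι ⁻¹' (B.extProj ι ⁻¹' e.baseSet)) := by
      refine (B.contMDiff_proj.continuous.comp continuous_fst).continuousOn.prodMk ?_
      refine ContinuousOn.mul ?_ continuous_snd.continuousOn
      exact hι.comp_continuousOn (continuous_snd.comp_continuousOn
        (e.continuousOn_toFun.comp continuous_fst.continuousOn hmaps))
    refine h1.congr ?_
    rintro ⟨u, h⟩ hu
    have hu' : B.proj u ∈ e.baseSet := hu
    change (B.proj u, if B.proj u ∈ e.baseSet then ι (e u).2 * h else 1) = _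
    rw [if_pos hu']
  continuousOn_invFun := by
    refine (B.isQuotientMap_extMk ι).continuous.comp_continuousOn ?_
    refine ContinuousOn.prodMk ?_ continuous_snd.continuousOn
    refine e.toOpenPartialHomeomorph.continuousOn_symm.comp
      (continuous_fst.prodMk continuous_const).continuousOn ?_
    rintro ⟨x, h⟩ ⟨hx, -⟩
    rw [e.target_eq]; exact ⟨hx, trivial⟩
  baseSet := e.baseSet
  open_baseSet := e.open_baseSet
  source_eq := rfl
  target_eq := rfl
  proj_toFun := by
    intro x hx
    obtain ⟨⟨u, h⟩, rfl⟩ := B.extMk_surjective ι x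
    rfl

theorem extTrivialization_mk (he : IsPrincipalTrivialization IP IM IG B.act e) {u : P}
    (hu : B.proj u ∈ e.baseSet) (h : H) :
    extTrivialization ι he (B.extMk ι (u, h)) = (B.proj u, ι (e u).2 * h) := by
  classical
  change (B.proj u, if B.proj u ∈ e.baseSet then ι (e u).2 * h else 1) = _
  rw [if_pos hu]

theorem extTrivialization_symm (he : IsPrincipalTrivialization IP IM IG B.act e) (y : M × H) :
    (extTrivialization ι he).toOpenPartialHomeomorph.symm y =
      B.extMk ι (e.toOpenPartialHomeomorph.symm (y.1, 1), y.2) := rfl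

/-- The charts of `P[H]`: a trivialization of `P[H]` induced by one of `P`, followed by charts of
`M` and `H`. -/
def extChart (ι : ContMDiffMonoidMorphism IG IH ∞ G H)
    (he : IsPrincipalTrivialization IP IM IG B.act e)
    (φ : OpenPartialHomeomorph M KM) (ψ : OpenPartialHomeomorph H KH) :
    OpenPartialHomeomorph (B.Ext ι) (ModelProd KM KH) :=
  (extTrivialization ι he).toOpenPartialHomeomorph ≫ₕ φ.prod ψ

variable (B)

instance : ChartedSpace (ModelProd KM KH) (B.Ext ι) where
  atlas := {c | ∃ (e : Bundle.Trivialization G B.proj)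
    (he : IsPrincipalTrivialization IP IM IG B.act e),
    ∃ φ ∈ atlas KM M, ∃ ψ ∈ atlas KH H, c = extChart ι he φ ψ}
  chartAt x := extChart ι (B.exists_trivialization (B.extProj ι x)).choose_spec.2
    (chartAt KM (B.extProj ι x))
    (chartAt KH (extTrivialization ι
      (B.exists_trivialization (B.extProj ι x)).choose_spec.2 x).2)
  mem_chart_source x := by
    have h1 := (B.exists_trivialization (B.extProj ι x)).choose_spec.1
    have he := (B.exists_trivialization (B.extProj ι x)).choose_spec.2
    have h2 : x ∈ (extTrivialization ι he).source := h1
    have h3 : (extTrivialization ι he x).1 = B.extProj ι x :=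
      (extTrivialization ι he).coe_fst h2
    refine ⟨h2, ?_, ?_⟩
    · change (extTrivialization ι he x).1 ∈ _
      rw [h3]; exact mem_chart_source _ _
    · exact mem_chart_source KH (extTrivialization ι he x).2
  chart_mem_atlas x := ⟨_, _, _, chart_mem_atlas _ _, _, chart_mem_atlas _ _, rfl⟩

variable {B}

theorem contMDiffOn_extTransition {e e' : Bundle.Trivialization G B.proj}
    (he : IsPrincipalTrivialization IP IM IG B.act e)
    (he' : IsPrincipalTrivialization IP IM IG B.act e') :
    ContMDiffOn (IM.prod IH) (IM.prod IH) ∞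
      (extTrivialization ι he' ∘ (extTrivialization ι he).toOpenPartialHomeomorph.symm)
      ((e.baseSet ∩ e'.baseSet) ×ˢ Set.univ) := by
  have hs : ContMDiffOn (IM.prod IH) IP ∞
      (fun y : M × H => e.toOpenPartialHomeomorph.symm (y.1, 1))
      ((e.baseSet ∩ e'.baseSet) ×ˢ Set.univ) := by
    refine he.contMDiffOn_symm.comp (contMDiff_fst.prodMk contMDiff_const).contMDiffOn ?_
    rintro ⟨x, h⟩ ⟨hx, -⟩
    rw [e.target_eq]; exact ⟨hx.1, trivial⟩
  have hp : ∀ y ∈ ((e.baseSet ∩ e'.baseSet) ×ˢ Set.univ : Set (M × H)),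
      B.proj (e.toOpenPartialHomeomorph.symm (y.1, 1)) = y.1 := by
    rintro ⟨x, h⟩ ⟨hx, -⟩
    exact e.proj_symm_apply (x := (x, 1)) (by rw [e.target_eq]; exact ⟨hx.1, trivial⟩)
  have h1 : ContMDiffOn (IM.prod IH) (IM.prod IH) ∞
      (fun y : M × H => (y.1, ι (e' (e.toOpenPartialHomeomorph.symm (y.1, 1))).2 * y.2))
      ((e.baseSet ∩ e'.baseSet) ×ˢ Set.univ) := by
    refine contMDiffOn_fst.prodMk (ContMDiffOn.mul ?_ contMDiffOn_snd)
    refine ι.contMDiff_toFun.comp_contMDiffOn (contMDiff_snd.comp_contMDiffOn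
      (he'.contMDiffOn.comp hs ?_))
    intro y hy
    rw [Set.mem_preimage, e'.mem_source, hp y hy]
    exact hy.1.2
  refine h1.congr ?_
  intro y hy
  rw [Function.comp_apply, extTrivialization_symm,
    extTrivialization_mk ι he' (by rw [hp y hy]; exact hy.1.2), hp y hy]

variable (B)

instance [IsManifold IM ∞ M] : IsManifold (IM.prod IH) ∞ (B.Ext ι) := by
  apply isManifold_of_contDiffOn
  rintro c c' ⟨e, he, φ, hφ, ψ, hψ, rfl⟩ ⟨e', he', φ', hφ', ψ', hψ', rfl⟩
  have hφ1 := IsManifold.subset_maximalAtlas (I := IM) (n := ∞) hφ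
  have hφ2 := IsManifold.subset_maximalAtlas (I := IM) (n := ∞) hφ'
  have hψ1 := IsManifold.subset_maximalAtlas (I := IH) (n := ∞) hψ
  have hψ2 := IsManifold.subset_maximalAtlas (I := IH) (n := ∞) hψ'
  refine contDiffOn_of_contMDiffOn_model ?_
  have h1 := contMDiffOn_symm_of_mem_maximalAtlas
    (IsManifold.mem_maximalAtlas_prod hφ1 hψ1)
  have h2 := contMDiffOn_of_mem_maximalAtlas
    (IsManifold.mem_maximalAtlas_prod hφ2 hψ2)
  have h3 := (contMDiffOn_extTransition ι he he').comp (h1.mono (t :=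
    ((extChart ι he φ ψ).symm ≫ₕ extChart ι he' φ' ψ').source) ?_) ?_
  · refine (h2.comp h3 ?_)
    intro z hz
    exact hz.2.2
  · intro z hz
    exact hz.1.1
  · intro z hz
    refine ⟨⟨hz.1.2.1, ?_⟩, trivial⟩
    have h4 := hz.2.1
    have h5 := (extTrivialization ι he).proj_symm_apply hz.1.2
    change B.extProj ι ((extTrivialization ι he).toOpenPartialHomeomorph.symm
      ((φ.prod ψ).symm z)) ∈ e'.baseSet at h4
    rw [h5] at h4
    exact h4

variable {B}

theorem contMDiffOn_extTrivialization [IsManifold IM ∞ M]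
    (he : IsPrincipalTrivialization IP IM IG B.act e) :
    ContMDiffOn (IM.prod IH) (IM.prod IH) ∞ (extTrivialization ι he)
      (extTrivialization ι he).source := by
  intro x hx
  set y := extTrivialization ι he x with hy
  have hφ := IsManifold.chart_mem_maximalAtlas (I := IM) (n := ∞) y.1
  have hψ := IsManifold.chart_mem_maximalAtlas (I := IH) (n := ∞) y.2
  have h1 := contMDiffOn_symm_of_mem_maximalAtlas (IsManifold.mem_maximalAtlas_prod hφ hψ)
  have hc : extChart ι he (chartAt KM y.1) (chartAt KH y.2) ∈
      IsManifold.maximalAtlas (IM.prod IH) ∞ (B.Ext ι) :=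
    IsManifold.subset_maximalAtlas
      ⟨e, he, _, chart_mem_atlas _ _, _, chart_mem_atlas _ _, rfl⟩
  have h2 := contMDiffOn_of_mem_maximalAtlas hc
  have hxs : x ∈ (extChart ι he (chartAt KM y.1) (chartAt KH y.2)).source :=
    ⟨hx, mem_chart_source KM y.1, mem_chart_source KH y.2⟩
  have h3 := h1.comp h2 (fun z hz =>
    ((chartAt KM y.1).prod (chartAt KH y.2)).map_source hz.2)
  have h4 := h3.contMDiffAt ((extChart ι he (chartAt KM y.1)
    (chartAt KH y.2)).open_source.mem_nhds hxs)
  refine (h4.congr_of_eventuallyEq ?_).contMDiffWithinAt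
  filter_upwards [(extChart ι he (chartAt KM y.1) (chartAt KH y.2)).open_source.mem_nhds hxs]
    with z hz
  exact (((chartAt KM y.1).prod (chartAt KH y.2)).left_inv hz.2).symm

theorem contMDiffOn_extTrivialization_symm [IsManifold IM ∞ M]
    (he : IsPrincipalTrivialization IP IM IG B.act e) :
    ContMDiffOn (IM.prod IH) (IM.prod IH) ∞
      (extTrivialization ι he).toOpenPartialHomeomorph.symm (extTrivialization ι he).target := by
  intro y hyt
  have hφ := IsManifold.chart_mem_maximalAtlas (I := IM) (n := ∞) y.1
  have hψ := IsManifold.chart_mem_maximalAtlas (I := IH) (n := ∞) y.2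
  have h1 := contMDiffOn_of_mem_maximalAtlas (IsManifold.mem_maximalAtlas_prod hφ hψ)
  have hc : extChart ι he (chartAt KM y.1) (chartAt KH y.2) ∈
      IsManifold.maximalAtlas (IM.prod IH) ∞ (B.Ext ι) :=
    IsManifold.subset_maximalAtlas
      ⟨e, he, _, chart_mem_atlas _ _, _, chart_mem_atlas _ _, rfl⟩
  have h2 := contMDiffOn_symm_of_mem_maximalAtlas hc
  have hys : y ∈ ((chartAt KM y.1).prod (chartAt KH y.2)).source :=
    ⟨mem_chart_source KM y.1, mem_chart_source KH y.2⟩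
  have ho : ((chartAt KM y.1).prod (chartAt KH y.2)).source ∩
      (extTrivialization ι he).target ∈ 𝓝 y :=
    Filter.inter_mem (((chartAt KM y.1).prod (chartAt KH y.2)).open_source.mem_nhds hys)
      ((extTrivialization ι he).open_target.mem_nhds hyt)
  have h3 := h2.comp (h1.mono Set.inter_subset_left) (s :=
      ((chartAt KM y.1).prod (chartAt KH y.2)).source ∩ (extTrivialization ι he).target) (by
    rintro z ⟨hz, hz'⟩
    refine ⟨OpenPartialHomeomorph.map_source _ hz, ?_⟩
    change ((chartAt KM y.1).prod (chartAt KH y.2)).symm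
      (((chartAt KM y.1).prod (chartAt KH y.2)) z) ∈ (extTrivialization ι he).target
    rw [OpenPartialHomeomorph.left_inv _ hz]; exact hz')
  have h4 := h3.contMDiffAt ho
  refine (h4.congr_of_eventuallyEq ?_).contMDiffWithinAt
  filter_upwards [ho] with z hz
  change _ = (extTrivialization ι he).toOpenPartialHomeomorph.symm
    (((chartAt KM y.1).prod (chartAt KH y.2)).symm
      (((chartAt KM y.1).prod (chartAt KH y.2)) z))
  rw [OpenPartialHomeomorph.left_inv _ hz.1]

theorem extTrivialization_act (he : IsPrincipalTrivialization IP IM IG B.act e)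
    {x : B.Ext ι} (hx : x ∈ (extTrivialization ι he).source) (k : H) :
    extTrivialization ι he (B.extAct ι x k) =
      ((extTrivialization ι he x).1, (extTrivialization ι he x).2 * k) := by
  obtain ⟨⟨u, h⟩, rfl⟩ := B.extMk_surjective ι x
  have hu : B.proj u ∈ e.baseSet := hx
  rw [extAct_mk, extTrivialization_mk ι he hu, extTrivialization_mk ι he hu, mul_assoc]

variable (B)

/-- The extension of the structure group: `P[H] = P ×_G H` as a principal `H`-bundle over `M`. -/
def extend [IsManifold IM ∞ M] : PrincipalBundle (IM.prod IH) IM IH (B.Ext ι) M H where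
  proj := B.extProj ι
  act := B.extAct ι
  contMDiff_proj := by
    intro x
    obtain ⟨e, hx, he⟩ := B.exists_trivialization (B.extProj ι x)
    have hs : (extTrivialization ι he).source ∈ 𝓝 x :=
      (extTrivialization ι he).open_source.mem_nhds hx
    have h := contMDiff_fst.contMDiffAt.comp x
      ((contMDiffOn_extTrivialization ι he).contMDiffAt hs)
    refine h.congr_of_eventuallyEq ?_
    filter_upwards [hs] with z hz
    exact ((extTrivialization ι he).coe_fst hz).symm
  contMDiff_act := by
    rintro ⟨x, k⟩
    obtain ⟨e, hx, he⟩ := B.exists_trivialization (B.extProj ι x)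
    have hs : Prod.fst ⁻¹' (extTrivialization ι he).source ∈ 𝓝 (x, k) :=
      ((extTrivialization ι he).open_source.preimage continuous_fst).mem_nhds hx
    have h1 := (contMDiffOn_extTrivialization ι he).comp
      (contMDiffOn_fst (I := IM.prod IH) (J := IH) (N := H)
        (s := Prod.fst ⁻¹' (extTrivialization ι he).source)) (fun z hz => hz)
    have h2 := (contMDiff_fst.comp_contMDiffOn h1).prodMk
      ((contMDiff_snd.comp_contMDiffOn h1).mul contMDiffOn_snd)
    have h3 := (contMDiffOn_extTrivialization_symm ι he).comp h2 (by
      rintro ⟨z, k'⟩ hz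
      exact ⟨((extTrivialization ι he).map_source hz).1, trivial⟩)
    refine (h3.contMDiffAt hs).congr_of_eventuallyEq ?_
    filter_upwards [hs] with z hz
    have h4 := extTrivialization_act ι he hz z.2
    have h5 : B.extAct ι z.1 z.2 ∈ (extTrivialization ι he).source := by
      rw [Bundle.Trivialization.mem_source, extProj_act]; exact hz
    have h6 := (extTrivialization ι he).toOpenPartialHomeomorph.left_inv h5
    exact h6.symm.trans (congrArg _ h4)
  act_one x := by
    obtain ⟨⟨u, h⟩, rfl⟩ := B.extMk_surjective ι x
    simp
  act_mul x k k' := by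
    obtain ⟨⟨u, h⟩, rfl⟩ := B.extMk_surjective ι x
    simp [mul_assoc]
  proj_act := B.extProj_act ι
  exists_trivialization x := by
    obtain ⟨e, hx, he⟩ := B.exists_trivialization x
    exact ⟨extTrivialization ι he, hx, contMDiffOn_extTrivialization ι he,
      contMDiffOn_extTrivialization_symm ι he,
      fun u hu g => by rw [extTrivialization_act ι he hu]⟩

end Extension

end PrincipalBundle
end PrincipalBundles
end

/-!
Write `μ` for the Maurer-Cartan form of `H`. The formula for `q^♭ κ` says exactly that its pullback
to `P × H` is `μ + Ad(h⁻¹) κ`, which determines `q^♭ κ` because `q` has local sections. The gauge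
formula `(s · γ)^* κ = Ad(ι(γ)⁻¹) s^* κ + (ι ∘ γ)^* μ` and the Leibniz rule for `μ` show that
`μ + Ad(h⁻¹) κ` does not distinguish `(u · g, h)` from `(u, ι(g) h)`; it therefore descends to
`P[H]`, smoothly since locally it is a pullback along a section of `q`.

Conversely, put `j(u) = q(u, 1)`, so that `q(u, h) = j(u) · h` and `j(u · g) = j(u) · ι(g)`. The
gauge formula for a principal connection `θ`, which is a generalized Cartan connection for
`H ⊆ H`, gives `q^* θ = μ + Ad(h⁻¹) j^* θ`, and shows that `j^* θ` is a generalized Cartan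
connection.
-/

noncomputable section

section Calculus

variable {𝕜 : Type*} [NontriviallyNormedField 𝕜] {EN KN EA KA EB KB EC KC : Type*}
  [NormedAddCommGroup EN] [NormedSpace 𝕜 EN] [TopologicalSpace KN]
  [NormedAddCommGroup EA] [NormedSpace 𝕜 EA] [TopologicalSpace KA]
  [NormedAddCommGroup EB] [NormedSpace 𝕜 EB] [TopologicalSpace KB]
  [NormedAddCommGroup EC] [NormedSpace 𝕜 EC] [TopologicalSpace KC]
  {IN : ModelWithCorners 𝕜 EN KN} {IA : ModelWithCorners 𝕜 EA KA}
  {IB : ModelWithCorners 𝕜 EB KB} {IC : ModelWithCorners 𝕜 EC KC}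
  {N A B C : Type*}
  [TopologicalSpace N] [ChartedSpace KN N] [TopologicalSpace A] [ChartedSpace KA A]
  [TopologicalSpace B] [ChartedSpace KB B] [TopologicalSpace C] [ChartedSpace KC C]
  {m n : ℕ∞ω}

theorem mfderiv_map₂ {f : A → B → C} {a : N → A} {b : N → B} {x : N}
    (hf : MDifferentiableAt (IA.prod IB) IC (fun p : A × B => f p.1 p.2) (a x, b x))
    (ha : MDifferentiableAt IN IA a x) (hb : MDifferentiableAt IN IB b x) :
    mfderiv IN IC (fun y => f (a y) (b y)) x =
      (mfderiv IA IC (fun z => f z (b x)) (a x)).comp (mfderiv IN IA a x) +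
        (mfderiv IB IC (fun z => f (a x) z) (b x)).comp (mfderiv IN IB b x) := by
  refine ContinuousLinearMap.ext fun v => ?_
  refine (mfderiv_comp_apply x (f := fun y => (a y, b y)) hf (ha.prodMk hb) v).trans ?_
  rw [mfderiv_prod_eq_add_apply hf, mfderiv_prodMk ha hb]
  rfl

theorem contMDiff_tangentMap_right [IsManifold IA 1 A] [IsManifold IB 1 B] [IsManifold IC 1 C]
    {f : A → B → C} (hf : ContMDiff (IA.prod IB) IC n fun p : A × B => f p.1 p.2)
    (hmn : m + 1 ≤ n) :
    ContMDiff (IA.prod IB.tangent) IC.tangent m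
      fun p : A × TangentBundle IB B => tangentMap IB IC (f p.1) p.2 := by
  have hzero : ContMDiff (IA.prod IB.tangent) (IA.tangent.prod IB.tangent) m
      fun p : A × TangentBundle IB B =>
        ((Bundle.zeroSection EA (TangentSpace IA) p.1 : TangentBundle IA A), p.2) :=
    ((Bundle.contMDiff_zeroSection 𝕜 (TangentSpace IA)).comp contMDiff_fst).prodMk contMDiff_snd
  convert! (hf.contMDiff_tangentMap hmn).comp
    ((contMDiff_equivTangentBundleProd_symm (I := IA) (I' := IB)).comp hzero) using 1
  ext1 ⟨x, y, v⟩
  refine Bundle.TotalSpace.ext rfl (heq_of_eq ?_)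
  have hmdiff : MDifferentiableAt (IA.prod IB) IC (fun p : A × B => f p.1 p.2) (x, y) :=
    hf.mdifferentiable (by rintro rfl; simp at hmn) _
  refine Eq.trans ?_
    (mfderiv_prod_eq_add_apply (I := IA) (I' := IB) (v := ((0 : EA), v)) hmdiff).symm
  change _ = mfderiv IA IC (fun z => f z y) x (0 : TangentSpace IA x) + mfderiv IB IC (f x) y v
  rw [map_zero, zero_add]
  rfl

theorem trivializationAt_snd_self [IsManifold IC 1 C] (v : TangentBundle IC C) :
    @Eq EC (trivializationAt EC (TangentSpace IC) v.proj v).2 v.2 := by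
  rw [TangentBundle.trivializationAt_apply]
  exact tangentCoordChange_self (mem_extChartAt_source v.proj)

theorem contMDiff_snd_of_proj_eq [IsManifold IC 1 C] {f : N → TangentBundle IC C}
    (hf : ContMDiff IN IC.tangent n f) {c : C} (hc : ∀ x, (f x).proj = c) :
    ContMDiff (M' := EC) IN 𝓘(𝕜, EC) n fun x => (f x).2 := by
  intro x
  have h := (Bundle.contMDiffAt_totalSpace.1 (hf x)).2
  refine h.congr_of_eventuallyEq (Filter.Eventually.of_forall fun y => ?_)
  change @Eq EC (f y).2 (trivializationAt EC (TangentSpace IC) (f x).proj (f y)).2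
  rw [(hc x).trans (hc y).symm, trivializationAt_snd_self]

theorem contMDiff_tangentBundle_mk [IsManifold IC 1 C] (c : C) :
    ContMDiff 𝓘(𝕜, EC) IC.tangent n fun v : EC => (⟨c, v⟩ : TangentBundle IC C) := fun _ =>
  Bundle.contMDiffAt_totalSpace.2 ⟨contMDiffAt_const, contMDiffAt_id.congr_of_eventuallyEq
    (Filter.Eventually.of_forall fun v => trivializationAt_snd_self ⟨c, v⟩)⟩

end Calculus

section OneForms

variable {𝕜 : Type*} [NontriviallyNormedField 𝕜] {EL KL EM KM EN KN F : Type*}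
  [NormedAddCommGroup EL] [NormedSpace 𝕜 EL] [TopologicalSpace KL]
  [NormedAddCommGroup EM] [NormedSpace 𝕜 EM] [TopologicalSpace KM]
  [NormedAddCommGroup EN] [NormedSpace 𝕜 EN] [TopologicalSpace KN]
  {IL : ModelWithCorners 𝕜 EL KL} {IM : ModelWithCorners 𝕜 EM KM} {IN : ModelWithCorners 𝕜 EN KN}
  {L M N : Type*}
  [TopologicalSpace L] [ChartedSpace KL L] [TopologicalSpace M] [ChartedSpace KM M]
  [TopologicalSpace N] [ChartedSpace KN N]

/-- A one-form on `M` with values in `F`, as a bare family of linear maps on the tangent spaces;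
its smoothness is the separate predicate `OneForm.IsSmooth`. -/
abbrev OneForm (IM : ModelWithCorners 𝕜 EM KM) (M : Type*) [TopologicalSpace M] [ChartedSpace KM M]
    (F : Type*) [TopologicalSpace F] [AddCommGroup F] [Module 𝕜 F] :=
  ∀ x : M, TangentSpace IM x →L[𝕜] F

/-- A map `σ` defined on `U ⊆ M` that is a smooth right inverse of `q : N → M`; the values of `σ`
outside the open set `U` are irrelevant. -/
structure IsLocalSection (IN : ModelWithCorners 𝕜 EN KN) (IM : ModelWithCorners 𝕜 EM KM)
    (q : N → M) (σ : M → N) (U : Set M) : Prop where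
  isOpen : IsOpen U
  contMDiffOn : ContMDiffOn IM IN ∞ σ U
  rightInvOn : Set.RightInvOn σ q U

namespace OneForm

section Pullback

variable [TopologicalSpace F] [AddCommGroup F] [Module 𝕜 F]

/-- The pullback `f^*α` of a one-form `α` along `f : N → M`; it is zero at the points where `f` is
not differentiable. -/
def pullback (IN : ModelWithCorners 𝕜 EN KN) (f : N → M) (α : OneForm IM M F) : OneForm IN N F :=
  fun x => (α (f x)).comp (mfderiv IN IM f x)

theorem pullback_apply (f : N → M) (α : OneForm IM M F) (x : N) (v : TangentSpace IN x) :
    pullback IN f α x v = α (f x) (mfderiv IN IM f x v) :=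
  rfl

theorem pullback_id (α : OneForm IM M F) : pullback IM id α = α := by
  funext x
  rw [pullback, mfderiv_id]
  rfl

theorem pullback_const (y : M) (α : OneForm IM M F) : pullback IN (fun _ : N => y) α = 0 := by
  funext x
  rw [pullback, mfderiv_const]
  exact ContinuousLinearMap.comp_zero _

theorem pullback_comp {g : M → L} {f : N → M} {x : N} (hg : MDifferentiableAt IM IL g (f x))
    (hf : MDifferentiableAt IN IM f x) (α : OneForm IL L F) :
    pullback IN (g ∘ f) α x = pullback IN f (pullback IM g α) x := by
  rw [pullback, mfderiv_comp x hg hf]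
  rfl

theorem congr_point (α : OneForm IM M F) {x y : M} (h : x = y) : @Eq (EM →L[𝕜] F) (α x) (α y) := by
  subst h
  rfl

theorem pullback_congr {f g : N → M} {x : N} (h : f =ᶠ[𝓝 x] g) (α : OneForm IM M F) :
    pullback IN f α x = pullback IN g α x := by
  have congr_deriv : @Eq (EN →L[𝕜] EM) (mfderiv IN IM f x) (mfderiv IN IM g x) := h.mfderiv_eq
  exact congrArg₂ ContinuousLinearMap.comp (congr_point α h.eq_of_nhds) congr_deriv

end Pullback

variable [NormedAddCommGroup F] [NormedSpace 𝕜 F]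

/-- A one-form is smooth if it is so as a function on the tangent bundle. -/
def IsSmooth (α : OneForm IM M F) [IsManifold IM 1 M] : Prop :=
  ContMDiff IM.tangent 𝓘(𝕜, F) ∞ fun v : TangentBundle IM M => α v.1 v.2

theorem IsSmooth.pullback [IsManifold IM 1 M] [IsManifold IN 1 N] {α : OneForm IM M F}
    (hα : IsSmooth α) {f : N → M} (hf : ContMDiff IN IM ∞ f) : IsSmooth (pullback IN f α) :=
  ContMDiff.comp hα (hf.contMDiff_tangentMap (by simp))

theorem IsSmooth.contMDiffOn_pullback [IsManifold IM 1 M] [IsManifold IN 1 N] {α : OneForm IM M F}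
    (hα : IsSmooth α) {f : N → M} {U : Set N} (hU : IsOpen U) (hf : ContMDiffOn IN IM ∞ f U) :
    ContMDiffOn IN.tangent 𝓘(𝕜, F) ∞
      (fun v : TangentBundle IN N => OneForm.pullback IN f α v.1 v.2)
      (Bundle.TotalSpace.proj ⁻¹' U) := by
  have h := ContMDiff.comp_contMDiffOn hα
    (hf.contMDiffOn_tangentMapWithin (m := ∞) (by simp) hU.uniqueMDiffOn)
  refine h.congr fun v hv => ?_
  exact congrArg (fun A : EN →L[𝕜] EM => α (f v.1) (A v.2)) (mfderivWithin_of_isOpen hU hv).symm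

end OneForm

namespace IsLocalSection

variable {q : N → M} {σ : M → N} {U : Set M}

theorem mdifferentiableAt (hσ : IsLocalSection IN IM q σ U) {y : M} (hy : y ∈ U) :
    MDifferentiableAt IM IN σ y :=
  (hσ.contMDiffOn.contMDiffAt (hσ.isOpen.mem_nhds hy)).mdifferentiableAt (by simp)

theorem pullback_pullback [TopologicalSpace F] [AddCommGroup F] [Module 𝕜 F]
    (hσ : IsLocalSection IN IM q σ U)
    (hq : MDifferentiable IN IM q) (β : OneForm IM M F) {y : M} (hy : y ∈ U) :
    OneForm.pullback IM σ (OneForm.pullback IN q β) y = β y := by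
  have hqσ : q ∘ σ =ᶠ[𝓝 y] id := Filter.eventually_of_mem (hσ.isOpen.mem_nhds hy) hσ.rightInvOn
  rw [← OneForm.pullback_comp (hq _) (hσ.mdifferentiableAt hy), OneForm.pullback_congr hqσ,
    OneForm.pullback_id]

end IsLocalSection

namespace OneForm

theorem pullback_injective [TopologicalSpace F] [AddCommGroup F] [Module 𝕜 F] {q : N → M}
    (hq : MDifferentiable IN IM q) (hσ : ∀ y, ∃ σ U, y ∈ U ∧ IsLocalSection IN IM q σ U) :
    Function.Injective (pullback IN q : OneForm IM M F → OneForm IN N F) := by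
  intro β β' h
  funext y
  obtain ⟨σ, U, hy, hσ⟩ := hσ y
  rw [← hσ.pullback_pullback hq β hy, h, hσ.pullback_pullback hq β' hy]

theorem exists_isSmooth_pullback_eq [NormedAddCommGroup F] [NormedSpace 𝕜 F]
    [IsManifold IM 1 M] [IsManifold IN 1 N] {q : N → M} (hq : MDifferentiable IN IM q)
    {α : OneForm IN N F} (hα : IsSmooth α)
    (hσ : ∀ y, ∃ σ U, y ∈ U ∧ IsLocalSection IN IM q σ U ∧
      ∀ x, q x ∈ U → pullback IN (σ ∘ q) α x = α x) :
    ∃ β : OneForm IM M F, IsSmooth β ∧ pullback IN q β = α := by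
  choose σ U hU hσ hα' using hσ
  let β : OneForm IM M F := fun y => pullback IM (σ y) α y
  have pullback_β : pullback IN q β = α := by
    funext x
    rw [← hα' (q x) x (hU (q x)),
      pullback_comp ((hσ (q x)).mdifferentiableAt (hU (q x))) (hq x)]
    rfl
  refine ⟨β, fun v => ?_, pullback_β⟩
  have hU' : Bundle.TotalSpace.proj ⁻¹' U v.1 ∈ 𝓝 v :=
    ((hσ v.1).isOpen.preimage
      (FiberBundle.continuous_proj EM (TangentSpace IM))).mem_nhds (hU v.1)
  refine ((hα.contMDiffOn_pullback (hσ v.1).isOpen (hσ v.1).contMDiffOn).contMDiffAt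
    hU').congr_of_eventuallyEq ?_
  filter_upwards [hU'] with w hw
  rw [← (hσ v.1).pullback_pullback hq β hw, pullback_β]

end OneForm

end OneForms

section MaurerCartan

variable {EN KN EG KG EH KH : Type*}
  [NormedAddCommGroup EN] [NormedSpace ℝ EN] [TopologicalSpace KN]
  [NormedAddCommGroup EG] [NormedSpace ℝ EG] [TopologicalSpace KG]
  [NormedAddCommGroup EH] [NormedSpace ℝ EH] [TopologicalSpace KH]
  {IN : ModelWithCorners ℝ EN KN} {IG : ModelWithCorners ℝ EG KG}
  {IH : ModelWithCorners ℝ EH KH} {N G H : Type*}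
  [TopologicalSpace N] [ChartedSpace KN N]
  [TopologicalSpace G] [ChartedSpace KG G] [Group G]
  [TopologicalSpace H] [ChartedSpace KH H] [Group H]

open OneForm

/-- The left Maurer-Cartan form, which sends `Z ∈ T_h H` to `T(λ_{h⁻¹}) Z ∈ 𝔥`. -/
def maurerCartan (IH : ModelWithCorners ℝ EH KH) : OneForm IH H (GroupLieAlgebra IH H) :=
  fun h => mfderiv IH IH (fun k : H => h⁻¹ * k) h

theorem maurerCartan_one :
    maurerCartan IH (1 : H) = ContinuousLinearMap.id ℝ (GroupLieAlgebra IH H) := by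
  have inv_one_mul : (fun k : H => (1 : H)⁻¹ * k) = id := by
    ext k
    simp
  rw [maurerCartan, inv_one_mul, mfderiv_id]

theorem lieAd_one : lieAd IH (1 : H) = ContinuousLinearMap.id ℝ (GroupLieAlgebra IH H) := by
  have conj_one : (fun k : H => (1 : H) * k * (1 : H)⁻¹) = id := by
    ext k
    simp
  rw [lieAd, conj_one, mfderiv_id]

section

variable [LieGroup IH ∞ H]

theorem mdifferentiableAt_conj (h k : H) :
    MDifferentiableAt IH IH (fun x : H => h * x * h⁻¹) k :=
  (mdifferentiable_mul_right (a := h⁻¹)).comp (mdifferentiable_mul_left (a := h)) k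

theorem lieAd_mul (h k : H) : lieAd IH (h * k) = (lieAd IH h).comp (lieAd IH k) := by
  have conj_comp_conj : (fun x : H => h * x * h⁻¹) ∘ (fun x : H => k * x * k⁻¹) =
      fun x : H => (h * k) * x * (h * k)⁻¹ := by
    ext x
    simp [mul_assoc]
  rw [lieAd, ← conj_comp_conj]
  exact ContinuousLinearMap.ext fun Y => mfderiv_comp_apply_of_eq (1 : H) (y := 1)
    (mdifferentiableAt_conj h 1) (mdifferentiableAt_conj k 1) (by simp) Y

theorem maurerCartan_mulInvariantVectorField (h : H) (Y : GroupLieAlgebra IH H) :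
    maurerCartan IH h (mulInvariantVectorField Y h) = Y := by
  have inv_mul_comp_mul : (fun k : H => h⁻¹ * k) ∘ (fun k : H => h * k) = id := by
    ext k
    simp
  refine (mfderiv_comp_apply_of_eq (I := IH) (I' := IH) (I'' := IH) (1 : H) (y := h)
    mdifferentiableAt_mul_left mdifferentiableAt_mul_left (mul_one h) Y).symm.trans ?_
  rw [inv_mul_comp_mul, mfderiv_id]
  rfl

theorem mulInvariantVectorField_maurerCartan (h : H) (Z : TangentSpace IH h) :
    mulInvariantVectorField (maurerCartan IH h Z) h = Z := by
  have mul_comp_inv_mul : (fun k : H => h * k) ∘ (fun k : H => h⁻¹ * k) = id := by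
    ext k
    simp
  refine (mfderiv_comp_apply_of_eq (I := IH) (I' := IH) (I'' := IH) h (y := 1)
    mdifferentiableAt_mul_left mdifferentiableAt_mul_left (inv_mul_cancel h) Z).symm.trans ?_
  rw [mul_comp_inv_mul, mfderiv_id]
  rfl

theorem pullback_mul_left_maurerCartan (h : H) :
    pullback IH (h * ·) (maurerCartan IH) = maurerCartan IH := by
  have inv_mul_comp_mul (k : H) :
      (fun x : H => (h * k)⁻¹ * x) ∘ (fun x : H => h * x) = fun x : H => k⁻¹ * x := by
    ext x
    simp [mul_assoc]
  refine funext fun k => ContinuousLinearMap.ext fun Z => ?_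
  refine (mfderiv_comp_apply (I := IH) (I' := IH) (I'' := IH) k
    mdifferentiableAt_mul_left mdifferentiableAt_mul_left Z).symm.trans ?_
  rw [inv_mul_comp_mul]
  rfl

theorem pullback_mul_right_maurerCartan (k h : H) :
    pullback IH (· * k) (maurerCartan IH) h = (lieAd IH k⁻¹).comp (maurerCartan IH h) := by
  have inv_mul_comp_mul : (fun x : H => (h * k)⁻¹ * x) ∘ (fun x : H => x * k) =
      (fun x : H => k⁻¹ * x * k⁻¹⁻¹) ∘ (fun x : H => h⁻¹ * x) := by
    ext x
    simp [mul_assoc]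
  refine ContinuousLinearMap.ext fun Z => ?_
  refine (mfderiv_comp_apply (I := IH) (I' := IH) (I'' := IH) h
    mdifferentiableAt_mul_left mdifferentiableAt_mul_right Z).symm.trans ?_
  rw [inv_mul_comp_mul]
  exact mfderiv_comp_apply_of_eq h (y := 1) (mdifferentiableAt_conj _ _)
    mdifferentiableAt_mul_left (by simp) Z

theorem pullback_mul_maurerCartan {a b : N → H} {x : N} (ha : MDifferentiableAt IN IH a x)
    (hb : MDifferentiableAt IN IH b x) :
    pullback IN (fun y => a y * b y) (maurerCartan IH) x =
      (lieAd IH (b x)⁻¹).comp (pullback IN a (maurerCartan IH) x) +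
        pullback IN b (maurerCartan IH) x := by
  have hmul : MDifferentiableAt (IH.prod IH) IH (fun p : H × H => p.1 * p.2) (a x, b x) :=
    (contMDiff_mul IH ∞).mdifferentiable (by simp) _
  have hleft := congrFun (pullback_mul_left_maurerCartan (IH := IH) (a x)) (b x)
  have hright := pullback_mul_right_maurerCartan (IH := IH) (b x) (a x)
  refine ContinuousLinearMap.ext fun v => ?_
  rw [pullback_apply, mfderiv_map₂ hmul ha hb]
  refine (map_add (maurerCartan IH (a x * b x)) _ _).trans ?_
  exact congrArg₂ (· + ·) (congrArg (fun A : EH →L[ℝ] EH => A (mfderiv IN IH a x v)) hright)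
    (congrArg (fun A : EH →L[ℝ] EH => A (mfderiv IN IH b x v)) hleft)

end

theorem pullback_hom_maurerCartan [LieGroup IG ∞ G] [LieGroup IH ∞ H]
    (ι : ContMDiffMonoidMorphism IG IH ∞ G H) (g : G) :
    pullback IG ι (maurerCartan IH) g = (mfderiv IG IH ι 1).comp (maurerCartan IG g) := by
  have hι : MDifferentiable IG IH ι := ι.contMDiff_toFun.mdifferentiable (by simp)
  have inv_mul_comp_hom : (fun x : H => (ι g)⁻¹ * x) ∘ ι = ι ∘ (fun x : G => g⁻¹ * x) := by
    ext x
    simp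
  refine ContinuousLinearMap.ext fun V => ?_
  refine (mfderiv_comp_apply (I := IG) (I' := IH) (I'' := IH) g
    mdifferentiableAt_mul_left (hι g) V).symm.trans ?_
  rw [inv_mul_comp_hom]
  exact mfderiv_comp_apply_of_eq g (y := 1) (hι 1) mdifferentiableAt_mul_left (by simp) V

variable [LieGroup IH ∞ H]

theorem isSmooth_maurerCartan : IsSmooth (F := EH) (maurerCartan IH (H := H)) :=
  contMDiff_snd_of_proj_eq
    ((contMDiff_tangentMap_right (m := ∞) (contMDiff_mul IH ∞) (by simp)).comp
      ((Bundle.contMDiff_proj (TangentSpace IH)).inv.prodMk contMDiff_id))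
    fun v => inv_mul_cancel v.1

theorem contMDiff_lieAd :
    ContMDiff (M' := EH) (IH.prod 𝓘(ℝ, EH)) 𝓘(ℝ, EH) ∞ fun p : H × EH => lieAd IH p.1 p.2 := by
  have hconj : ContMDiff (IH.prod IH) IH ∞ fun p : H × H => p.1 * p.2 * p.1⁻¹ :=
    (contMDiff_fst.mul contMDiff_snd).mul contMDiff_fst.inv
  exact contMDiff_snd_of_proj_eq (c := (1 : H))
    ((contMDiff_tangentMap_right (f := fun x y : H => x * y * x⁻¹) hconj (m := ∞) (by simp)).comp
      (contMDiff_fst.prodMk ((contMDiff_tangentBundle_mk 1).comp contMDiff_snd)))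
    fun p => by simp [tangentMap]

end MaurerCartan

section ExtensionForm

variable {EN KN EP KP EH KH : Type*}
  [NormedAddCommGroup EN] [NormedSpace ℝ EN] [TopologicalSpace KN]
  [NormedAddCommGroup EP] [NormedSpace ℝ EP] [TopologicalSpace KP]
  [NormedAddCommGroup EH] [NormedSpace ℝ EH] [TopologicalSpace KH]
  {IN : ModelWithCorners ℝ EN KN} {IP : ModelWithCorners ℝ EP KP} {IH : ModelWithCorners ℝ EH KH}
  {N P H : Type*}
  [TopologicalSpace N] [ChartedSpace KN N]
  [TopologicalSpace P] [ChartedSpace KP P]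
  [TopologicalSpace H] [ChartedSpace KH H] [Group H]

open OneForm

/-- The one-form `(X, Z) ↦ μ(Z) + Ad(h⁻¹) α(X)` on `P × H`, where `μ` is the Maurer-Cartan form;
for a generalized Cartan connection `α` it is the pullback `q^*(q^♭ α)`. -/
def extensionForm (α : OneForm IP P (GroupLieAlgebra IH H)) :
    OneForm (IP.prod IH) (P × H) (GroupLieAlgebra IH H) :=
  fun p => pullback (IP.prod IH) Prod.snd (maurerCartan IH) p +
    (lieAd IH p.2⁻¹).comp (pullback (IP.prod IH) Prod.fst α p)

theorem extensionForm_apply (α : OneForm IP P (GroupLieAlgebra IH H)) (u : P) (h : H)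
    (X : TangentSpace IP u) (Z : TangentSpace IH h) :
    extensionForm α (u, h) (X, Z) = maurerCartan IH h Z + lieAd IH h⁻¹ (α u X) := by
  rw [extensionForm, pullback, pullback, mfderiv_fst, mfderiv_snd]
  rfl

theorem pullback_prodMk_extensionForm (α : OneForm IP P (GroupLieAlgebra IH H)) {f : N → P}
    {b : N → H} {x : N} (hf : MDifferentiableAt IN IP f x) (hb : MDifferentiableAt IN IH b x) :
    pullback IN (fun y => (f y, b y)) (extensionForm α) x =
      pullback IN b (maurerCartan IH) x + (lieAd IH (b x)⁻¹).comp (pullback IN f α x) := by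
  refine ContinuousLinearMap.ext fun v => ?_
  rw [pullback_apply, mfderiv_prodMk hf hb]
  exact extensionForm_apply α (f x) (b x) _ _

theorem pullback_prodMk_one_extensionForm (α : OneForm IP P (GroupLieAlgebra IH H)) :
    pullback IP (fun u => (u, (1 : H))) (extensionForm α) = α := by
  funext u
  rw [pullback_prodMk_extensionForm (f := fun u => u) α mdifferentiableAt_id
    mdifferentiableAt_const, pullback_const, inv_one, lieAd_one]
  refine (zero_add _).trans ?_
  exact congrFun (pullback_id α) u

theorem isSmooth_extensionForm [IsManifold IP 1 P] [LieGroup IH ∞ H]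
    {α : OneForm IP P (GroupLieAlgebra IH H)} (hα : IsSmooth (F := EH) α) :
    IsSmooth (F := EH) (extensionForm α) := by
  have hsnd : IsSmooth (F := EH) (pullback (IP.prod IH) (Prod.snd : P × H → H) (maurerCartan IH)) :=
    isSmooth_maurerCartan.pullback contMDiff_snd
  have hfst : IsSmooth (F := EH) (pullback (IP.prod IH) (Prod.fst : P × H → P) α) :=
    hα.pullback contMDiff_fst
  have hinv : ContMDiff (IP.prod IH).tangent IH ∞
      fun v : TangentBundle (IP.prod IH) (P × H) => v.1.2⁻¹ :=
    (contMDiff_snd.comp (Bundle.contMDiff_proj (TangentSpace (IP.prod IH)))).inv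
  exact hsnd.add (contMDiff_lieAd.comp (hinv.prodMk hfst))

variable [LieGroup IH ∞ H]

theorem eq_extensionForm_iff {α : OneForm IP P (GroupLieAlgebra IH H)}
    {β : OneForm (IP.prod IH) (P × H) (GroupLieAlgebra IH H)} :
    β = extensionForm α ↔ ∀ (u : P) (h : H) (X : TangentSpace IP u) (Y : GroupLieAlgebra IH H),
      β (u, h) (X, mulInvariantVectorField Y h) = Y + lieAd IH h⁻¹ (α u X) := by
  constructor
  · rintro rfl u h X Y
    rw [extensionForm_apply, maurerCartan_mulInvariantVectorField]
  · refine fun hβ => funext fun ⟨u, h⟩ => ContinuousLinearMap.ext fun ⟨X, Z⟩ => ?_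
    refine Eq.trans ?_ ((hβ u h X (maurerCartan IH h Z)).trans (extensionForm_apply α u h X Z).symm)
    exact congrArg (fun W : EH => β (u, h) (X, W)) (mulInvariantVectorField_maurerCartan h Z).symm

theorem pullback_mul_right_extensionForm (α : OneForm IP P (GroupLieAlgebra IH H)) (k : H)
    (p : P × H) :
    pullback (IP.prod IH) (fun p : P × H => (p.1, p.2 * k)) (extensionForm α) p =
      (lieAd IH k⁻¹).comp (extensionForm α p) := by
  have hmul : MDifferentiableAt (IP.prod IH) IH (fun p : P × H => p.2 * k) p :=
    (mdifferentiable_mul_right (a := k) p.2).comp p mdifferentiableAt_snd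
  rw [pullback_prodMk_extensionForm α mdifferentiableAt_fst hmul,
    pullback_mul_maurerCartan mdifferentiableAt_snd mdifferentiableAt_const, pullback_const,
    mul_inv_rev, lieAd_mul, extensionForm]
  refine (congrArg (· + _) (add_zero _)).trans ?_
  exact ContinuousLinearMap.ext fun v => (map_add (lieAd IH k⁻¹) _ _).symm

end ExtensionForm

namespace PrincipalBundle

open OneForm

section Gauge

variable {EN KN EP KP EM KM EG KG EH KH F : Type*}
  [NormedAddCommGroup EN] [NormedSpace ℝ EN] [TopologicalSpace KN]
  [NormedAddCommGroup EP] [NormedSpace ℝ EP] [TopologicalSpace KP]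
  [NormedAddCommGroup EM] [NormedSpace ℝ EM] [TopologicalSpace KM]
  [NormedAddCommGroup EG] [NormedSpace ℝ EG] [TopologicalSpace KG]
  [NormedAddCommGroup EH] [NormedSpace ℝ EH] [TopologicalSpace KH]
  {IN : ModelWithCorners ℝ EN KN}
  {IP : ModelWithCorners ℝ EP KP} {IM : ModelWithCorners ℝ EM KM}
  {IG : ModelWithCorners ℝ EG KG} {IH : ModelWithCorners ℝ EH KH}
  {N P M G H : Type*}
  [TopologicalSpace N] [ChartedSpace KN N]
  [TopologicalSpace P] [ChartedSpace KP P]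
  [TopologicalSpace M] [ChartedSpace KM M]
  [TopologicalSpace G] [ChartedSpace KG G] [Group G]
  [TopologicalSpace H] [ChartedSpace KH H] [Group H]

section Action

variable (B : PrincipalBundle IP IM IG P M G)

theorem mdifferentiable_act_left (g : G) : MDifferentiable IP IP fun u => B.act u g :=
  (B.contMDiff_act.comp (contMDiff_id.prodMk contMDiff_const)).mdifferentiable (by simp)

theorem mdifferentiable_act_right (u : P) : MDifferentiable IG IP (B.act u) :=
  (B.contMDiff_act.comp (contMDiff_const.prodMk contMDiff_id)).mdifferentiable (by simp)

theorem mdifferentiableAt_act {f : N → P} {γ : N → G} {x : N} (hf : MDifferentiableAt IN IP f x)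
    (hγ : MDifferentiableAt IN IG γ x) : MDifferentiableAt IN IP (fun y => B.act (f y) (γ y)) x :=
  (B.contMDiff_act.mdifferentiable (by simp) (f x, γ x)).comp x (hf.prodMk hγ)

theorem mfderiv_act_right [LieGroup IG ∞ G] (u : P) (g : G) (V : TangentSpace IG g) :
    mfderiv IG IP (B.act u) g V = B.fundamental (maurerCartan IG g V) (B.act u g) := by
  have act_comp_inv_mul : B.act (B.act u g) ∘ (fun x : G => g⁻¹ * x) = B.act u := by
    ext x
    simp [← B.act_mul]
  refine Eq.trans ?_ (mfderiv_comp_apply_of_eq (I := IG) (I' := IG) (I'' := IP) g (y := 1)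
    (B.mdifferentiable_act_right (B.act u g) _) mdifferentiableAt_mul_left (inv_mul_cancel g) V)
  rw [act_comp_inv_mul]

theorem pullback_act_one_apply [TopologicalSpace F] [AddCommGroup F] [Module ℝ F]
    (α : OneForm IP P F) (u : P) (X : GroupLieAlgebra IG G) :
    pullback IG (B.act u) α 1 X = α u (B.fundamental X u) :=
  congrArg (fun A : EP →L[ℝ] F => A (B.fundamental X u)) (congr_point α (B.act_one u))

end Action

variable [IsManifold IP ∞ P] {B : PrincipalBundle IP IM IG P M G}

section

variable {ι : ContMDiffMonoidMorphism IG IH ∞ G H}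

theorem GeneralizedCartanConnection.form_injective :
    Function.Injective (form : B.GeneralizedCartanConnection ι → _) := by
  rintro ⟨⟩ ⟨⟩ rfl
  rfl

variable [LieGroup IG ∞ G] [LieGroup IH ∞ H]

theorem GeneralizedCartanConnection.pullback_act (κ : B.GeneralizedCartanConnection ι)
    {f : N → P} {γ : N → G} {x : N} (hf : MDifferentiableAt IN IP f x)
    (hγ : MDifferentiableAt IN IG γ x) :
    pullback IN (fun y => B.act (f y) (γ y)) κ.form x =
      (lieAd IH (ι (γ x))⁻¹).comp (pullback IN f κ.form x) +
        pullback IN (fun y => ι (γ y)) (maurerCartan IH) x := by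
  have hι : MDifferentiable IG IH ι := ι.contMDiff_toFun.mdifferentiable (by simp)
  have pullback_ι : pullback IN (fun y => ι (γ y)) (maurerCartan IH) x =
      (mfderiv IG IH ι 1).comp ((maurerCartan IG (γ x)).comp (mfderiv IN IG γ x)) := by
    refine (pullback_comp (hι _) hγ _).trans ?_
    rw [pullback, pullback_hom_maurerCartan]
    rfl
  refine ContinuousLinearMap.ext fun v => ?_
  rw [pullback_apply, mfderiv_map₂ (B.contMDiff_act.mdifferentiable (by simp) _) hf hγ, pullback_ι]
  refine (map_add (κ.form (B.act (f x) (γ x))) _ _).trans (congrArg₂ (· + ·) ?_ ?_)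
  · refine (κ.equivariant _ _ _).trans ?_
    rw [map_inv]
    rfl
  · refine (congrArg (κ.form (B.act (f x) (γ x))) (B.mfderiv_act_right _ _ _)).trans ?_
    exact κ.reproduces _ _

/-- This is the sense in which `extensionForm κ.form` is basic for `q : P × H → P[H]`. -/
theorem GeneralizedCartanConnection.pullback_act_extensionForm
    (κ : B.GeneralizedCartanConnection ι) {f : N → P} {γ : N → G} {b : N → H} {x : N}
    (hf : MDifferentiableAt IN IP f x) (hγ : MDifferentiableAt IN IG γ x)
    (hb : MDifferentiableAt IN IH b x) :
    pullback IN (fun y => (B.act (f y) (γ y), b y)) (extensionForm κ.form) x =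
      pullback IN (fun y => (f y, ι (γ y) * b y)) (extensionForm κ.form) x := by
  have hιγ : MDifferentiableAt IN IH (fun y => ι (γ y)) x :=
    (ι.contMDiff_toFun.mdifferentiable (by simp) _).comp x hγ
  have hmul : MDifferentiableAt IN IH (fun y => ι (γ y) * b y) x :=
    ((contMDiff_mul IH ∞).mdifferentiable (by simp) (ι (γ x), b x)).comp x (hιγ.prodMk hb)
  rw [pullback_prodMk_extensionForm _ (B.mdifferentiableAt_act hf hγ) hb,
    pullback_prodMk_extensionForm _ hf hmul, κ.pullback_act hf hγ,
    pullback_mul_maurerCartan hιγ hb, mul_inv_rev, lieAd_mul]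
  refine ContinuousLinearMap.ext fun v => ?_
  refine (congrArg (_ + ·) (map_add (lieAd IH (b x)⁻¹) _ _)).trans ?_
  exact ((add_rotate _ _ _).trans (add_assoc _ _ _)).symm

end

namespace PrincipalConnection

theorem form_injective : Function.Injective (form : B.PrincipalConnection → _) := by
  rintro ⟨⟩ ⟨⟩ rfl
  rfl

/-- A principal connection, regarded as a generalized Cartan connection for `G ⊆ G`. -/
def toGeneralizedCartanConnection (θ : B.PrincipalConnection) :
    B.GeneralizedCartanConnection (IH := IG) ⟨MonoidHom.id G, contMDiff_id⟩ where
  form := θ.form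
  smooth := θ.smooth
  equivariant := θ.equivariant
  reproduces u X := (θ.reproduces u X).trans (congrArg (fun A : EG →L[ℝ] EG => A X)
    (mfderiv_id (I := IG) (x := (1 : G))).symm)

theorem pullback_act [LieGroup IG ∞ G] (θ : B.PrincipalConnection) {f : N → P} {γ : N → G} {x : N}
    (hf : MDifferentiableAt IN IP f x) (hγ : MDifferentiableAt IN IG γ x) :
    pullback IN (fun y => B.act (f y) (γ y)) θ.form x =
      (lieAd IG (γ x)⁻¹).comp (pullback IN f θ.form x) + pullback IN γ (maurerCartan IG) x :=
  θ.toGeneralizedCartanConnection.pullback_act hf hγ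

end PrincipalConnection

end Gauge

section Extension

variable {EP KP EM KM EG KG EH KH : Type*}
  [NormedAddCommGroup EP] [NormedSpace ℝ EP] [TopologicalSpace KP]
  [NormedAddCommGroup EM] [NormedSpace ℝ EM] [TopologicalSpace KM]
  [NormedAddCommGroup EG] [NormedSpace ℝ EG] [TopologicalSpace KG]
  [NormedAddCommGroup EH] [NormedSpace ℝ EH] [TopologicalSpace KH]
  {IP : ModelWithCorners ℝ EP KP} {IM : ModelWithCorners ℝ EM KM}
  {IG : ModelWithCorners ℝ EG KG} {IH : ModelWithCorners ℝ EH KH}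
  {P M G H : Type*}
  [TopologicalSpace P] [ChartedSpace KP P]
  [TopologicalSpace M] [ChartedSpace KM M]
  [TopologicalSpace G] [ChartedSpace KG G] [Group G]
  [TopologicalSpace H] [ChartedSpace KH H] [Group H]
  {B : PrincipalBundle IP IM IG P M G} {e : Bundle.Trivialization G B.proj}

theorem contMDiffOn_symm_one (he : IsPrincipalTrivialization IP IM IG B.act e) :
    ContMDiffOn IM IP ∞ (fun x => e.toOpenPartialHomeomorph.symm (x, 1)) e.baseSet :=
  he.contMDiffOn_symm.comp (contMDiff_id.prodMk contMDiff_const).contMDiffOn fun x hx => by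
    rw [Set.mem_preimage, e.target_eq]
    exact ⟨hx, trivial⟩

theorem contMDiffOn_trivialization_snd (he : IsPrincipalTrivialization IP IM IG B.act e) :
    ContMDiffOn IP IG ∞ (fun u => (e u).2) (B.proj ⁻¹' e.baseSet) :=
  contMDiff_snd.comp_contMDiffOn (he.contMDiffOn.mono fun _ hu => e.mem_source.2 hu)

variable (ι : ContMDiffMonoidMorphism IG IH ∞ G H) [LieGroup IH ∞ H]

/-- The local section of `q : P × H → P[H]` with values in `s(U) × H`, where `s` is the section of
`P` over `U` that corresponds to the unit of `G` (with junk values away from `U`). -/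
def extSection (he : IsPrincipalTrivialization IP IM IG B.act e) (y : B.Ext ι) : P × H :=
  (e.toOpenPartialHomeomorph.symm (B.extProj ι y, 1), (extTrivialization ι he y).2)

theorem extSection_extMk (he : IsPrincipalTrivialization IP IM IG B.act e) {u : P}
    (hu : B.proj u ∈ e.baseSet) (h : H) :
    extSection ι he (B.extMk ι (u, h)) =
      (e.toOpenPartialHomeomorph.symm (B.proj u, 1), ι (e u).2 * h) := by
  rw [extSection, extTrivialization_mk ι he hu, extProj_mk]

theorem extMk_extSection (he : IsPrincipalTrivialization IP IM IG B.act e) :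
    Set.RightInvOn (extSection ι he) (B.extMk ι) (B.extProj ι ⁻¹' e.baseSet) := by
  intro y hy
  obtain ⟨⟨u, h⟩, rfl⟩ := B.extMk_surjective ι y
  rw [extSection_extMk ι he hy, ← B.extMk_act, trivialization_inv_act he hy]

variable {ι} in
theorem GeneralizedCartanConnection.pullback_extSection_extMk [IsManifold IP ∞ P] [LieGroup IG ∞ G]
    (κ : B.GeneralizedCartanConnection ι) (he : IsPrincipalTrivialization IP IM IG B.act e)
    {p : P × H} (hp : B.proj p.1 ∈ e.baseSet) :
    pullback (IP.prod IH) (extSection ι he ∘ B.extMk ι) (extensionForm κ.form) p =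
      extensionForm κ.form p := by
  have hbase : (fun p : P × H => B.proj p.1) ⁻¹' e.baseSet ∈ 𝓝 p :=
    (e.open_baseSet.preimage (B.contMDiff_proj.continuous.comp continuous_fst)).mem_nhds hp
  have mdifferentiableAt_symm_one : MDifferentiableAt (IP.prod IH) IP
      (fun p : P × H => e.toOpenPartialHomeomorph.symm (B.proj p.1, 1)) p :=
    (((contMDiffOn_symm_one he).comp (B.contMDiff_proj.comp contMDiff_fst).contMDiffOn
      fun _ hp => hp).contMDiffAt hbase).mdifferentiableAt (by simp)
  have mdifferentiableAt_snd_triv : MDifferentiableAt (IP.prod IH) IG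
      (fun p : P × H => (e p.1).2) p :=
    (((contMDiffOn_trivialization_snd he).comp contMDiffOn_fst
      fun _ hp => hp).contMDiffAt hbase).mdifferentiableAt (by simp)
  have extSection_extMk_eq : extSection ι he ∘ B.extMk ι =ᶠ[𝓝 p] fun p =>
      (e.toOpenPartialHomeomorph.symm (B.proj p.1, 1), ι (e p.1).2 * p.2) :=
    Filter.eventually_of_mem hbase fun p hp => extSection_extMk ι he hp p.2
  have symm_one_act_eq : (fun p : P × H =>
      (B.act (e.toOpenPartialHomeomorph.symm (B.proj p.1, 1)) (e p.1).2, p.2)) =ᶠ[𝓝 p] id :=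
    Filter.eventually_of_mem hbase fun p hp => Prod.ext (trivialization_inv_act he hp) rfl
  rw [pullback_congr extSection_extMk_eq, ← κ.pullback_act_extensionForm
    mdifferentiableAt_symm_one mdifferentiableAt_snd_triv mdifferentiableAt_snd,
    pullback_congr symm_one_act_eq, pullback_id]

variable [IsManifold IM ∞ M]

variable (B) in
theorem contMDiff_extMk : ContMDiff (IP.prod IH) (IM.prod IH) ∞ (B.extMk ι) := by
  intro p
  obtain ⟨e, hp, he⟩ := B.exists_trivialization (B.proj p.1)
  let U : Set (P × H) := (fun p => B.proj p.1) ⁻¹' e.baseSet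
  have hU : U ∈ 𝓝 p :=
    (e.open_baseSet.preimage (B.contMDiff_proj.continuous.comp continuous_fst)).mem_nhds hp
  have contMDiffOn_coord : ContMDiffOn (IP.prod IH) (IM.prod IH) ∞
      (fun p : P × H => (B.proj p.1, ι (e p.1).2 * p.2)) U :=
    (B.contMDiff_proj.comp contMDiff_fst).contMDiffOn.prodMk
      ((ι.contMDiff_toFun.comp_contMDiffOn ((contMDiffOn_trivialization_snd he).comp
        contMDiffOn_fst fun _ hp => hp)).mul contMDiffOn_snd)
  have contMDiffOn_symm_coord := (contMDiffOn_extTrivialization_symm ι he).comp contMDiffOn_coord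
    fun p hp => ⟨hp, trivial⟩
  refine (contMDiffOn_symm_coord.contMDiffAt hU).congr_of_eventuallyEq ?_
  filter_upwards [hU] with p hp
  have left_inv := (extTrivialization ι he).toOpenPartialHomeomorph.left_inv
    (x := B.extMk ι p) ((extTrivialization ι he).mem_source.2 hp)
  exact left_inv.symm.trans (congrArg _ (extTrivialization_mk ι he hp p.2))

variable (B) in
theorem mdifferentiable_extMk : MDifferentiable (IP.prod IH) (IM.prod IH) (B.extMk ι) :=
  (B.contMDiff_extMk ι).mdifferentiable (by simp)

variable (B) in
theorem contMDiff_extMk_one : ContMDiff IP (IM.prod IH) ∞ fun u => B.extMk ι (u, 1) :=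
  (B.contMDiff_extMk ι).comp (contMDiff_id.prodMk contMDiff_const)

theorem isLocalSection_extSection (he : IsPrincipalTrivialization IP IM IG B.act e) :
    IsLocalSection (IP.prod IH) (IM.prod IH) (B.extMk ι) (extSection ι he)
      (B.extProj ι ⁻¹' e.baseSet) where
  isOpen := e.open_baseSet.preimage (B.continuous_extProj ι)
  contMDiffOn := ((contMDiffOn_symm_one he).comp
    (B.extend ι).contMDiff_proj.contMDiffOn fun _ hy => hy).prodMk
      (contMDiff_snd.comp_contMDiffOn (contMDiffOn_extTrivialization ι he))
  rightInvOn := extMk_extSection ι he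

theorem pullback_extMk_injective {F : Type*} [TopologicalSpace F] [AddCommGroup F] [Module ℝ F] :
    Function.Injective (pullback (IP.prod IH) (B.extMk ι) :
      OneForm (IM.prod IH) (B.Ext ι) F → OneForm (IP.prod IH) (P × H) F) :=
  pullback_injective (B.mdifferentiable_extMk ι) fun y =>
    have ⟨_, hy, he⟩ := B.exists_trivialization (B.extProj ι y)
    ⟨_, _, hy, isLocalSection_extSection ι he⟩

variable {ι}

theorem PrincipalConnection.pullback_extMk_act_one (θ : (B.extend ι).PrincipalConnection)
    {EN KN N : Type*} [NormedAddCommGroup EN] [NormedSpace ℝ EN] [TopologicalSpace KN]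
    {IN : ModelWithCorners ℝ EN KN} [TopologicalSpace N] [ChartedSpace KN N]
    {f : N → P} {γ : N → G} {x : N} (hf : MDifferentiableAt IN IP f x)
    (hγ : MDifferentiableAt IN IG γ x) :
    pullback IN (fun y => B.extMk ι (B.act (f y) (γ y), 1)) θ.form x =
      (lieAd IH (ι (γ x))⁻¹).comp (pullback IN (fun y => B.extMk ι (f y, 1)) θ.form x) +
        pullback IN (fun y => ι (γ y)) (maurerCartan IH) x := by
  have extMk_act_one : (fun y => B.extMk ι (B.act (f y) (γ y), 1)) =
      fun y => (B.extend ι).act (B.extMk ι (f y, 1)) (ι (γ y)) :=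
    funext fun y => (B.extMk_act ι (f y) (γ y) 1).trans (by simp [extend])
  rw [extMk_act_one]
  exact θ.pullback_act (f := fun y => B.extMk ι (f y, 1)) (γ := fun y => ι (γ y))
    (((B.contMDiff_extMk_one ι).mdifferentiable (by simp) _).comp x hf)
    ((ι.contMDiff_toFun.mdifferentiable (by simp) _).comp x hγ)

variable [IsManifold IP ∞ P]

section Extend

variable [LieGroup IG ∞ G] (κ : B.GeneralizedCartanConnection ι)

namespace GeneralizedCartanConnection

theorem exists_isSmooth_pullback_extMk_eq :
    ∃ θ : OneForm (IM.prod IH) (B.Ext ι) (GroupLieAlgebra IH H),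
      IsSmooth (F := EH) θ ∧ pullback (IP.prod IH) (B.extMk ι) θ = extensionForm κ.form :=
  exists_isSmooth_pullback_eq (F := EH) (B.mdifferentiable_extMk ι)
    (isSmooth_extensionForm κ.smooth) fun y =>
      have ⟨_, hy, he⟩ := B.exists_trivialization (B.extProj ι y)
      ⟨_, _, hy, isLocalSection_extSection ι he, fun _ => κ.pullback_extSection_extMk he⟩

/-- The one-form `q^♭ κ` on `P[H]`, chosen among the smooth forms whose pullback to `P × H` is
`extensionForm κ.form`; it is unique by `pullback_extMk_injective`. -/
def extForm : OneForm (IM.prod IH) (B.Ext ι) (GroupLieAlgebra IH H) :=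
  κ.exists_isSmooth_pullback_extMk_eq.choose

theorem isSmooth_extForm : IsSmooth (F := EH) κ.extForm :=
  κ.exists_isSmooth_pullback_extMk_eq.choose_spec.1

theorem pullback_extMk_extForm :
    pullback (IP.prod IH) (B.extMk ι) κ.extForm = extensionForm κ.form :=
  κ.exists_isSmooth_pullback_extMk_eq.choose_spec.2

theorem pullback_extAct_extForm (y : B.Ext ι) (k : H) :
    pullback (IM.prod IH) (fun z => B.extAct ι z k) κ.extForm y =
      (lieAd IH k⁻¹).comp (κ.extForm y) := by
  have hq := B.mdifferentiable_extMk ι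
  have hact := (B.extend ι).mdifferentiable_act_left k
  refine congrFun (pullback_extMk_injective ι
    (a₁ := pullback (IM.prod IH) (fun z => B.extAct ι z k) κ.extForm)
    (a₂ := fun z => (lieAd IH k⁻¹).comp (κ.extForm z)) (funext fun p => ?_)) y
  have hmul : MDifferentiableAt (IP.prod IH) (IP.prod IH) (fun p : P × H => (p.1, p.2 * k)) p :=
    mdifferentiableAt_fst.prodMk
      ((mdifferentiable_mul_right (a := k) p.2).comp p mdifferentiableAt_snd)
  refine (pullback_comp (hact _) (hq p) κ.extForm).symm.trans ?_
  refine (pullback_comp (f := fun p : P × H => (p.1, p.2 * k)) (hq _) hmul κ.extForm).trans ?_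
  rw [pullback_extMk_extForm, pullback_mul_right_extensionForm, ← pullback_extMk_extForm]
  rfl

theorem extForm_fundamental (y : B.Ext ι) (Y : GroupLieAlgebra IH H) :
    κ.extForm y ((B.extend ι).fundamental Y y) = Y := by
  obtain ⟨⟨u, h⟩, rfl⟩ := B.extMk_surjective ι y
  have pullback_orbit : pullback IH ((B.extend ι).act (B.extMk ι (u, h))) κ.extForm 1 =
      maurerCartan IH 1 := by
    refine (pullback_comp (g := B.extMk ι) (f := fun k : H => (u, h * k))
      (B.mdifferentiable_extMk ι _)
      (mdifferentiableAt_const.prodMk mdifferentiableAt_mul_left) _).trans ?_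
    rw [pullback_extMk_extForm, pullback_prodMk_extensionForm _ mdifferentiableAt_const
      mdifferentiableAt_mul_left, pullback_mul_left_maurerCartan, pullback_const]
    exact (congrArg (_ + ·) (ContinuousLinearMap.comp_zero _)).trans (add_zero _)
  rw [← pullback_act_one_apply, pullback_orbit, maurerCartan_one]
  rfl

/-- The principal connection `q^♭ κ` on `P[H]`. -/
def extend : (B.extend ι).PrincipalConnection where
  form := κ.extForm
  smooth := κ.isSmooth_extForm
  equivariant y k v :=
    congrArg (fun A : EM × EH →L[ℝ] EH => A v) (κ.pullback_extAct_extForm y k)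
  reproduces := κ.extForm_fundamental

end GeneralizedCartanConnection

end Extend

namespace PrincipalConnection

variable (θ : (B.extend ι).PrincipalConnection)

/-- The generalized Cartan connection `(q^♭)⁻¹ θ`, the pullback of `θ` along `u ↦ q(u, 1)`. -/
def restrict : B.GeneralizedCartanConnection ι where
  form := pullback IP (fun u => B.extMk ι (u, 1)) θ.form
  smooth := IsSmooth.pullback (F := EH) θ.smooth (B.contMDiff_extMk_one ι)
  equivariant u g X := by
    have pullback_act_left : pullback IP (fun v => B.act v g)
        (pullback IP (fun v => B.extMk ι (v, 1)) θ.form) u =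
        (lieAd IH (ι g⁻¹)).comp (pullback IP (fun v => B.extMk ι (v, 1)) θ.form u) := by
      refine (pullback_comp (f := fun v => B.act v g)
        ((B.contMDiff_extMk_one ι).mdifferentiable (by simp) _)
        (B.mdifferentiable_act_left g u) θ.form).symm.trans ?_
      refine (θ.pullback_extMk_act_one (f := fun v => v) mdifferentiableAt_id
        mdifferentiableAt_const).trans ?_
      rw [pullback_const, map_inv]
      exact add_zero _
    exact congrArg (fun A : EP →L[ℝ] EH => A X) pullback_act_left
  reproduces u X := by
    have pullback_orbit : pullback IG (B.act u)
        (pullback IP (fun v => B.extMk ι (v, 1)) θ.form) 1 = mfderiv IG IH ι 1 := by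
      refine (pullback_comp (f := B.act u)
        ((B.contMDiff_extMk_one ι).mdifferentiable (by simp) _)
        (B.mdifferentiable_act_right u 1) θ.form).symm.trans ?_
      refine (θ.pullback_extMk_act_one (f := fun _ => u) (γ := fun g => g) mdifferentiableAt_const
        mdifferentiableAt_id).trans ?_
      rw [pullback_const]
      refine (congrArg (· + _) (ContinuousLinearMap.comp_zero _)).trans ((zero_add _).trans ?_)
      exact congrArg (fun A : EH →L[ℝ] EH => A.comp (mfderiv IG IH ι 1 : EG →L[ℝ] EH))
        ((congr_point (maurerCartan IH) (map_one ι)).trans maurerCartan_one)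
    refine (pullback_act_one_apply B _ u X).symm.trans ?_
    exact congrArg (fun A : EG →L[ℝ] EH => A X) pullback_orbit

theorem restrict_apply (u : P) (X : TangentSpace IP u) :
    θ.restrict.form u X = θ.form (B.extMk ι (u, 1))
      (mfderiv (IP.prod IH) (IM.prod IH) (B.extMk ι) (u, 1)
        (X, (0 : TangentSpace IH (1 : H)))) := by
  refine congrArg (θ.form (B.extMk ι (u, 1))) ?_
  refine (mfderiv_comp_apply u (f := fun u : P => (u, (1 : H))) (B.mdifferentiable_extMk ι _)
    (mdifferentiableAt_id.prodMk mdifferentiableAt_const) X).trans ?_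
  rw [mfderiv_prod_left]
  rfl

theorem pullback_extMk_form :
    pullback (IP.prod IH) (B.extMk ι) θ.form = extensionForm θ.restrict.form := by
  have hj := (B.contMDiff_extMk_one ι).mdifferentiable (by simp)
  have extMk_eq : B.extMk ι = fun p => (B.extend ι).act (B.extMk ι (p.1, 1)) p.2 :=
    funext fun p => by simp [extend]
  funext p
  rw [extMk_eq]
  refine (θ.pullback_act (f := (fun u => B.extMk ι (u, 1)) ∘ Prod.fst) (γ := Prod.snd)
    ((hj _).comp p mdifferentiableAt_fst) mdifferentiableAt_snd).trans ?_
  rw [pullback_comp (hj _) mdifferentiableAt_fst]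
  exact add_comm _ _

end PrincipalConnection

variable (B ι) in
/-- The bijection `κ ↦ q^♭ κ`. -/
def connectionEquiv [LieGroup IG ∞ G] :
    B.GeneralizedCartanConnection ι ≃ (B.extend ι).PrincipalConnection where
  toFun κ := κ.extend
  invFun θ := θ.restrict
  left_inv κ := by
    refine GeneralizedCartanConnection.form_injective (funext fun u => ?_)
    refine (pullback_comp (f := fun u : P => (u, (1 : H))) (B.mdifferentiable_extMk ι _)
      (mdifferentiableAt_id.prodMk mdifferentiableAt_const) _).trans ?_
    change pullback IP _ (pullback (IP.prod IH) (B.extMk ι) κ.extForm) u = _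
    rw [κ.pullback_extMk_extForm, pullback_prodMk_one_extensionForm]
  right_inv θ := PrincipalConnection.form_injective <| pullback_extMk_injective ι <|
    θ.restrict.pullback_extMk_extForm.trans θ.pullback_extMk_form.symm

end Extension

end PrincipalBundle

end

theorem lemma3p2_general {EP KP EM KM EG KG EH KH : Type*}
    [NormedAddCommGroup EP] [NormedSpace ℝ EP] [TopologicalSpace KP]
    [NormedAddCommGroup EM] [NormedSpace ℝ EM] [TopologicalSpace KM]
    [NormedAddCommGroup EG] [NormedSpace ℝ EG] [TopologicalSpace KG]
    [NormedAddCommGroup EH] [NormedSpace ℝ EH] [TopologicalSpace KH]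
    (IP : ModelWithCorners ℝ EP KP)
    (IM : ModelWithCorners ℝ EM KM)
    (IG : ModelWithCorners ℝ EG KG)
    (IH : ModelWithCorners ℝ EH KH)
    {P M G H : Type*}
    [TopologicalSpace P] [ChartedSpace KP P] [IsManifold IP ∞ P]
    [TopologicalSpace M] [ChartedSpace KM M] [IsManifold IM ∞ M]
    [TopologicalSpace G] [ChartedSpace KG G] [Group G] [LieGroup IG ∞ G]
    [TopologicalSpace H] [ChartedSpace KH H] [Group H] [LieGroup IH ∞ H]
    (B : PrincipalBundle IP IM IG P M G)
    (ι : ContMDiffMonoidMorphism IG IH ∞ G H) :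
    ∃ F : B.GeneralizedCartanConnection ι ≃ (B.extend ι).PrincipalConnection,
      (∀ (κ : B.GeneralizedCartanConnection ι) (u : P) (h : H) (X : TangentSpace IP u)
          (Y : GroupLieAlgebra IH H),
        (F κ).form (B.extMk ι (u, h))
            (mfderiv (IP.prod IH) (IM.prod IH) (B.extMk ι) (u, h)
              (X, mulInvariantVectorField Y h))
          = Y + lieAd IH h⁻¹ (κ.form u X)) ∧
      (∀ (θ : (B.extend ι).PrincipalConnection) (u : P) (X : TangentSpace IP u),
        (F.symm θ).form u X
          = θ.form (B.extMk ι (u, 1))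
              (mfderiv (IP.prod IH) (IM.prod IH) (B.extMk ι) (u, 1)
                (X, (0 : TangentSpace IH (1 : H))))) ∧
      (∀ (κ : B.GeneralizedCartanConnection ι)
          (θ : ∀ y : B.Ext ι, TangentSpace (IM.prod IH) y →L[ℝ] GroupLieAlgebra IH H),
        (∀ (u : P) (h : H) (X : TangentSpace IP u) (Y : GroupLieAlgebra IH H),
          θ (B.extMk ι (u, h))
              (mfderiv (IP.prod IH) (IM.prod IH) (B.extMk ι) (u, h)
                (X, mulInvariantVectorField Y h))
            = Y + lieAd IH h⁻¹ (κ.form u X)) →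
        θ = (F κ).form) := by
  refine ⟨PrincipalBundle.connectionEquiv B ι, fun κ => ?_, fun θ => θ.restrict_apply,
    fun κ θ hθ => ?_⟩
  · exact eq_extensionForm_iff.1 κ.pullback_extMk_extForm
  · exact PrincipalBundle.pullback_extMk_injective ι
      ((eq_extensionForm_iff.2 hθ).trans κ.pullback_extMk_extForm.symm)

theorem lemma3p2 {EP KP EM KM EG KG EH KH : Type*}
    [NormedAddCommGroup EP] [NormedSpace ℝ EP] [FiniteDimensional ℝ EP] [TopologicalSpace KP]
    [NormedAddCommGroup EM] [NormedSpace ℝ EM] [FiniteDimensional ℝ EM] [TopologicalSpace KM]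
    [NormedAddCommGroup EG] [NormedSpace ℝ EG] [FiniteDimensional ℝ EG] [TopologicalSpace KG]
    [NormedAddCommGroup EH] [NormedSpace ℝ EH] [FiniteDimensional ℝ EH] [TopologicalSpace KH]
    (IP : ModelWithCorners ℝ EP KP) [IP.Boundaryless]
    (IM : ModelWithCorners ℝ EM KM) [IM.Boundaryless]
    (IG : ModelWithCorners ℝ EG KG) [IG.Boundaryless]
    (IH : ModelWithCorners ℝ EH KH) [IH.Boundaryless]
    {P M G H : Type*}
    [TopologicalSpace P] [ChartedSpace KP P] [IsManifold IP ∞ P]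
    [TopologicalSpace M] [ChartedSpace KM M] [IsManifold IM ∞ M]
    [TopologicalSpace G] [ChartedSpace KG G] [Group G] [LieGroup IG ∞ G]
    [TopologicalSpace H] [ChartedSpace KH H] [Group H] [LieGroup IH ∞ H]
    (B : PrincipalBundle IP IM IG P M G)
    (ι : ContMDiffMonoidMorphism IG IH ∞ G H) (hι : IsLieSubgroup ι) :
    ∃ F : B.GeneralizedCartanConnection ι ≃ (B.extend ι).PrincipalConnection,
      -- the explicit formula for the correspondence
      (∀ (κ : B.GeneralizedCartanConnection ι) (u : P) (h : H) (X : TangentSpace IP u)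
          (Y : GroupLieAlgebra IH H),
        (F κ).form (B.extMk ι (u, h))
            (mfderiv (IP.prod IH) (IM.prod IH) (B.extMk ι) (u, h)
              (X, mulInvariantVectorField Y h))
          = Y + lieAd IH h⁻¹ (κ.form u X)) ∧
      -- the explicit formula for its inverse
      (∀ (θ : (B.extend ι).PrincipalConnection) (u : P) (X : TangentSpace IP u),
        (F.symm θ).form u X
          = θ.form (B.extMk ι (u, 1))
              (mfderiv (IP.prod IH) (IM.prod IH) (B.extMk ι) (u, 1)
                (X, (0 : TangentSpace IH (1 : H))))) ∧
      -- the first formula determines the form `F κ` uniquely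
      (∀ (κ : B.GeneralizedCartanConnection ι)
          (θ : ∀ y : B.Ext ι, TangentSpace (IM.prod IH) y →L[ℝ] GroupLieAlgebra IH H),
        (∀ (u : P) (h : H) (X : TangentSpace IP u) (Y : GroupLieAlgebra IH H),
          θ (B.extMk ι (u, h))
              (mfderiv (IP.prod IH) (IM.prod IH) (B.extMk ι) (u, h)
                (X, mulInvariantVectorField Y h))
            = Y + lieAd IH h⁻¹ (κ.form u X)) →
        θ = (F κ).form) :=
  lemma3p2_general IP IM IG IH B ι
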